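/- Let $R$ be a non-regular complete Noetherian local domain of dimension one with maximal ideal $\mathfrak m$, which is an algebra over its residue field $k$, where $k$ is algebraically closed of characteristic $0$. Let $k[[t]]$ be the integral closure of $R$ in its fraction field $Q$, let $v$ be the $t$-adic order on $k[[t]]$, and let $c_R$ be the integer such that the conductor $\{q\in Q : q\,k[[t]]\subseteq R\}$ equals $t^{c_R}k[[t]]$. Write $R=k[[\alpha_1t^{a_1},\dots,\alpha_nt^{a_n}]]$ with integers $1\le a_1<\dots<a_n$ and units $\alpha_i$ of $k[[t]]$. For a unit $\alpha=\sum_{i\ge 0}c_it^i$ put $o(\alpha)=v(\alpha-c_0)\in\{1,2,\dots\}\cup\{\infty\}$. Let $r$ be an index with $o(\alpha_r)=\min_{1\le i\le n}o(\alpha_i)$, and let $a=\min_{j\ne r}a_j$. (Here $n\ge 2$ because $R$ is not regular.) If $o(\alpha_r)+a\ge c_R$, then $R$ is quasihomogeneous, i.e. there is a surjective $R$-linear map $\Omega_R\twoheadrightarrow\mathfrak m$. Here $\Omega_R$ is the universally finite module of differentials: for $R\cong k[[X_1,\dots,X_m]]/I$ it is the quotient of $R^m$ by the submodule spanned by the images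 of the vectors $(\partial f/\partial X_1,\dots,\partial f/\partial X_m)$, $f\in I$; up to isomorphism it does not depend on the presentation. In fact there is a uniformizer $s$ of $k[[t]]$ such that $R$ is the semigroup ring of its value semigroup $v(R)=\{v(x): 0\ne x\in R\}$ with respect to $s$, that is, $R=\{\sum_{h\in v(R)}c_hs^h : c_h\in k\}$; and, if $r\neq 1$ or if $a_1$ divides none of $a_2,\dots,a_n$, then with the same $s$ also $R=k[[s^{a_1},\dots,s^{a_n}]]$. -/

import Mathlib

open scoped PowerSeries

/-- `k⟦x₁, …, xₙ⟧ ⊆ k⟦t⟧`: the set of all power series in `x₁, …, xₙ ∈ k⟦t⟧` (meant for `xᵢ`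
with zero constant term, where every substitution converges). -/
def powerSeriesIn {k : Type*} [Field k] {n : ℕ} (x : Fin n → k⟦X⟧) : Set k⟦X⟧ :=
  Set.range fun p : MvPowerSeries (Fin n) k => (MvPowerSeries.subst x p : k⟦X⟧)

/-- The order `o(α)` of a unit `α = ∑ cᵢ tⁱ` of `k⟦t⟧`: the least `i ≥ 1` with `cᵢ ≠ 0`, and `∞` if
`α` is constant. -/
noncomputable def unitOrder {k : Type*} [Field k] (α : k⟦X⟧) : ℕ∞ :=
  (α - PowerSeries.C (PowerSeries.constantCoeff α)).order

/-- The conductor `R :_Q S = {q ∈ Q ∣ q S ⊆ R}`, for rings `R → S → Q`. -/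
def conductorSet (R S Q : Type*) [CommRing R] [CommRing S] [CommRing Q] [Algebra R Q]
    [Algebra S Q] : Set Q :=
  {q | ∀ f : S, q * algebraMap S Q f ∈ Set.range (algebraMap R Q)}

/-- The value semigroup `v(R) = {v(x) ∣ 0 ≠ x ∈ R}` of a ring `R → k⟦t⟧`. -/
def valueSemigroup (k R : Type*) [Field k] [CommRing R] [Algebra R k⟦X⟧] : Set ℕ :=
  {h | ∃ x : R, (algebraMap R k⟦X⟧ x).order = (h : ℕ∞)}

/-- For `s ∈ k⟦t⟧` of positive order and `H ⊆ ℕ`, the set of all series `∑_{h ∈ H} c_h s^h` with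
`c_h ∈ k`. -/
def seriesWithExponents {k : Type*} [Field k] (s : k⟦X⟧) (H : Set ℕ) : Set k⟦X⟧ :=
  {g | ∃ f : k⟦X⟧, (∀ h, h ∉ H → PowerSeries.coeff h f = 0) ∧ PowerSeries.subst s f = g}

section Differentials

variable {k R : Type*} [Field k] [CommRing R] [Algebra k R] {n : ℕ}

/-- For a presentation `π : k⟦X₁, …, Xₙ⟧ → R` with kernel `I`, the submodule of `Rⁿ` spanned by
the vectors `(∂f/∂X₁, …, ∂f/∂Xₙ)` with `f ∈ I`. By the product rule it is already spanned
by those of a generating set of `I`, i.e. it is the image of the Jacobian matrix of `I`. -/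
def jacobianRelations (π : MvPowerSeries (Fin n) k →ₐ[k] R) : Submodule R (Fin n → R) :=
  Submodule.span R
    {w | ∃ f : MvPowerSeries (Fin n) k, π f = 0 ∧ w = fun i => π (MvPowerSeries.pderiv k i f)}

/-- The universally finite module of differentials `Ω_R` over `k`, computed from a presentation
`π : k⟦X₁, …, Xₙ⟧ ↠ R`: the cokernel of the Jacobian matrix. -/
abbrev UniversallyFiniteDifferentials (π : MvPowerSeries (Fin n) k →ₐ[k] R) : Type _ :=
  (Fin n → R) ⧸ jacobianRelations π

end Differentials

/-- `R` is quasihomogeneous: `R` has a presentation as a quotient of a power series ring over `k`,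
and `Ω_R` surjects onto the maximal ideal. Since `Ω_R` does not depend on the presentation up to
isomorphism, the surjection is asked for with every presentation. -/
def IsQuasihomogeneous (k R : Type*) [Field k] [CommRing R] [Algebra k R] [IsLocalRing R] : Prop :=
  (∃ (n : ℕ) (π : MvPowerSeries (Fin n) k →ₐ[k] R), Function.Surjective π) ∧
  ∀ (n : ℕ) (π : MvPowerSeries (Fin n) k →ₐ[k] R), Function.Surjective π →
    ∃ φ : UniversallyFiniteDifferentials π →ₗ[R] IsLocalRing.maximalIdeal R, Function.Surjective φ

/-!
The idea is to absorb the unit `αᵣ` into the uniformizer. In characteristic `0` there is a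
uniformizer `s = t β` with `αᵣ t ^ aᵣ = bᵣ s ^ aᵣ`, where `bᵢ` is the constant term of `αᵢ`
(`PowerSeries.exists_pow_eq_of_X_pow_dvd_sub_one`), and `β ≡ 1` modulo `t ^ o(αᵣ)`. As `o(αᵣ)` is
minimal, every other generator is `bⱼ s ^ aⱼ` modulo `t ^ (aⱼ + o(αᵣ))`, hence modulo the conductor.
So `R` contains all `s ^ aᵢ` and differs from the ring generated by them only in the conductor,
which makes it the semigroup ring of its values (`PowerSeries.mem_range_iff_coeff_eq_zero`).
Changes of uniformizer are automorphisms of `k⟦t⟧` (`PowerSeries.substAlgEquiv`), so all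
computations with such rings are done for `s = t`.

The `s ^ aᵢ` generate `R` if and only if every exponent from the conductor on lies in the semigroup
generated by the `aᵢ`. That this holds if `r` is not the first index, or if `a₁` divides no other
exponent, is `PowerSeries.mem_generatedSemigroup_of_X_pow_mem_range`. It rests on the fact that
replacing perturbed monomials by monomials changes the value of a power series `p` by a linear
combination of the perturbations, up to terms of order at least `c + a₁`
(`PowerSeries.X_pow_dvd_algHom_sub_sub_sum`).

A semigroup ring is stable under the Euler derivation `s d/ds`, whose image on it is the maximal
ideal; this derivation induces the surjection from the module of differentials
(`isQuasihomogeneous_of_range_eq_seriesWithExponents`).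

Homomorphisms from a power series ring to `k⟦t⟧` are compared by writing a series as its constant
term plus a combination of the variables and inducting on the `t`-adic precision.
-/

/-! ### Algebra homomorphisms from a power series ring to `k⟦t⟧` -/

/-- Every power series is its constant term plus a combination of the variables, and the
constant terms of the coefficients are the linear coefficients. -/
theorem MvPowerSeries.exists_eq_C_add_sum_X_mul {k : Type*} [CommSemiring k] {n : ℕ}
    (p : MvPowerSeries (Fin n) k) :
    ∃ q : Fin n → MvPowerSeries (Fin n) k,
      (∀ i, constantCoeff (q i) = coeff (Finsupp.single i 1) p) ∧
      p = C (constantCoeff p) + ∑ i, X i * q i := by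
  classical
  -- A monomial `e ≠ 0` is assigned to the first variable that divides it.
  obtain ⟨q, hq⟩ : ∃ q : Fin n → MvPowerSeries (Fin n) k, ∀ i e, coeff e (q i) =
      if ∀ j < i, e j = 0 then coeff (e + Finsupp.single i 1) p else 0 :=
    ⟨fun i e => if ∀ j < i, e j = 0 then coeff (e + Finsupp.single i 1) p else 0,
      fun _ _ => rfl⟩
  refine ⟨q, fun i => ?_, ?_⟩
  · rw [← coeff_zero_eq_constantCoeff_apply, hq]
    simp
  · ext e
    have key : ∀ i, coeff e (X i * q i) =
        if e i ≠ 0 ∧ ∀ j < i, e j = 0 then coeff e p else 0 := by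
      intro i
      rw [show (X i : MvPowerSeries (Fin n) k) = monomial (Finsupp.single i 1) 1 from rfl,
        coeff_monomial_mul]
      by_cases h : Finsupp.single i 1 ≤ e
      · have hi : e i ≠ 0 := by
          have := h i
          simp at this; omega
        rw [if_pos h, one_mul, hq, tsub_add_cancel_of_le h]
        congr 1
        simp only [hi, ne_eq, not_false_eq_true, true_and, eq_iff_iff]
        refine forall₂_congr fun j hj => ?_
        simp [Finsupp.single_eq_of_ne hj.ne]
      · have hi : e i = 0 := by
          by_contra hi
          exact h (by simpa using Nat.one_le_iff_ne_zero.2 hi)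
        simp [hi]
    rw [map_add, map_sum, coeff_C, Finset.sum_congr rfl fun i _ => key i]
    by_cases he : e = 0
    · simp [he]
    · obtain ⟨i₁, hi₁⟩ : ∃ i, e i ≠ 0 := by
        by_contra! h
        exact he (Finsupp.ext h)
      obtain ⟨i₀, hi₀, hmin⟩ := exists_minimal_of_wellFoundedLT (fun i => e i ≠ 0) ⟨i₁, hi₁⟩
      have hlt : ∀ j < i₀, e j = 0 := fun j hj => by
        by_contra h
        exact absurd (hmin h hj.le) (not_le.2 hj)
      rw [if_neg he, zero_add, Finset.sum_eq_single i₀, if_pos ⟨hi₀, hlt⟩]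
      · intro i _ hi
        refine if_neg ?_
        rintro ⟨h1, h2⟩
        rcases lt_or_gt_of_ne hi with h | h
        · exact h1 (hlt i h)
        · exact hi₀ (h2 i₀ h)
      · simp

namespace PowerSeries

variable {k : Type*} [Field k] {n : ℕ}

theorem algHom_C (φ : MvPowerSeries (Fin n) k →ₐ[k] k⟦X⟧) (b : k) :
    φ (MvPowerSeries.C b) = C b := φ.commutes b

/-- Algebra homomorphisms between power series rings are automatically local: if the image of `Xᵢ`
had constant term `b ≠ 0`, then the unit `Xᵢ - b` would have a non-unit as its image. -/
theorem X_dvd_algHom_X (φ : MvPowerSeries (Fin n) k →ₐ[k] k⟦X⟧) (i : Fin n) :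
    X ∣ φ (MvPowerSeries.X i) := by
  rw [X_dvd_iff]
  by_contra h
  set b := constantCoeff (φ (MvPowerSeries.X i)) with hb
  have hu : IsUnit (MvPowerSeries.X i - MvPowerSeries.C b : MvPowerSeries (Fin n) k) := by
    rw [MvPowerSeries.isUnit_iff_constantCoeff]
    simpa using h
  have := (hu.map φ).map (constantCoeff (R := k))
  rw [map_sub, algHom_C, map_sub, ← hb] at this
  simp at this

theorem eq_zero_of_forall_X_pow_dvd {f : k⟦X⟧} (h : ∀ N, X ^ N ∣ f) : f = 0 := by
  ext m
  exact X_pow_dvd_iff.1 (h (m + 1)) m (Nat.lt_succ_self m)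

/-- Homomorphisms that agree modulo `t ^ N` on the variables agree modulo `t ^ N`. Each
application of the decomposition of a series into variables times series gains a power of `t`. -/
theorem X_pow_dvd_algHom_sub (φ ψ : MvPowerSeries (Fin n) k →ₐ[k] k⟦X⟧) {N : ℕ}
    (h : ∀ i, X ^ N ∣ φ (MvPowerSeries.X i) - ψ (MvPowerSeries.X i))
    (p : MvPowerSeries (Fin n) k) : X ^ N ∣ φ p - ψ p := by
  suffices H : ∀ M ≤ N, ∀ p, X ^ M ∣ φ p - ψ p from H N le_rfl p
  intro M
  induction M with
  | zero => simp
  | succ M ih =>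
    intro hM p
    obtain ⟨q, -, hq⟩ := p.exists_eq_C_add_sum_X_mul
    have : φ p - ψ p = ∑ i, ((φ (MvPowerSeries.X i) - ψ (MvPowerSeries.X i)) * φ (q i) +
        ψ (MvPowerSeries.X i) * (φ (q i) - ψ (q i))) := by
      rw [hq]
      simp only [map_add, map_sum, map_mul, algHom_C, add_sub_add_left_eq_sub,
        ← Finset.sum_sub_distrib]
      exact Finset.sum_congr rfl fun i _ => by ring
    rw [this]
    refine Finset.dvd_sum fun i _ => dvd_add ?_ ?_
    · exact ((pow_dvd_pow X hM).trans (h i)).mul_right _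
    · rw [pow_succ']
      exact mul_dvd_mul (X_dvd_algHom_X ψ i) (ih (by omega) _)

theorem constantCoeff_algHom (φ : MvPowerSeries (Fin n) k →ₐ[k] k⟦X⟧)
    (p : MvPowerSeries (Fin n) k) :
    constantCoeff (φ p) = MvPowerSeries.constantCoeff p := by
  obtain ⟨q, -, hq⟩ := p.exists_eq_C_add_sum_X_mul
  have h0 : ∀ i, constantCoeff (φ (MvPowerSeries.X i)) = 0 := fun i =>
    X_dvd_iff.1 (X_dvd_algHom_X φ i)
  conv_lhs => rw [hq]
  simp [algHom_C, h0]

/-- If all variables have images of order at least `b` under both homomorphisms, and these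
images agree modulo `t ^ m`, then the difference of the homomorphisms at `p` depends only on the
linear part of `p`, modulo `t ^ (m + b)`. -/
theorem X_pow_dvd_algHom_sub_sub_sum (φ ψ : MvPowerSeries (Fin n) k →ₐ[k] k⟦X⟧) {m b : ℕ}
    (hφ : ∀ i, X ^ b ∣ φ (MvPowerSeries.X i)) (hψ : ∀ i, X ^ b ∣ ψ (MvPowerSeries.X i))
    (h : ∀ i, X ^ m ∣ φ (MvPowerSeries.X i) - ψ (MvPowerSeries.X i))
    (p : MvPowerSeries (Fin n) k) :
    X ^ (m + b) ∣ φ p - ψ p - ∑ i, C (MvPowerSeries.coeff (Finsupp.single i 1) p) *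
      (φ (MvPowerSeries.X i) - ψ (MvPowerSeries.X i)) := by
  obtain ⟨q, hq0, hq⟩ := p.exists_eq_C_add_sum_X_mul
  have : φ p - ψ p - ∑ i, C (MvPowerSeries.coeff (Finsupp.single i 1) p) *
      (φ (MvPowerSeries.X i) - ψ (MvPowerSeries.X i)) =
      ∑ i, ((φ (MvPowerSeries.X i) - ψ (MvPowerSeries.X i)) *
        (φ (q i) - C (MvPowerSeries.constantCoeff (q i))) +
        (φ (q i) - ψ (q i)) * ψ (MvPowerSeries.X i)) := by
    simp only [← hq0]
    conv_lhs => rw [hq]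
    simp only [map_add, map_sum, map_mul, algHom_C, add_sub_add_left_eq_sub,
      ← Finset.sum_sub_distrib]
    exact Finset.sum_congr rfl fun i _ => by ring
  rw [this]
  refine Finset.dvd_sum fun i _ => ?_
  rw [pow_add]
  refine dvd_add (mul_dvd_mul (h i) ?_) (mul_dvd_mul (X_pow_dvd_algHom_sub φ ψ h _) (hψ i))
  obtain ⟨q', -, hq'⟩ := (q i).exists_eq_C_add_sum_X_mul
  have : φ (q i) - C (MvPowerSeries.constantCoeff (q i)) =
      ∑ j, φ (MvPowerSeries.X j) * φ (q' j) := by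
    conv_lhs => rw [hq']
    simp [algHom_C]
  rw [this]
  exact Finset.dvd_sum fun j _ => (hφ j).mul_right _

/-- The chain rule for an arbitrary derivation of `k⟦t⟧` over `k`; no continuity is needed since the
defect of the formula is divisible by every power of `t`. -/
theorem derivation_algHom_apply (D : Derivation k k⟦X⟧ k⟦X⟧)
    (φ : MvPowerSeries (Fin n) k →ₐ[k] k⟦X⟧) (p : MvPowerSeries (Fin n) k) :
    D (φ p) = ∑ i, φ (MvPowerSeries.pderiv k i p) * D (φ (MvPowerSeries.X i)) := by
  have hC : ∀ b : k, D (C b) = 0 := fun b => D.map_algebraMap b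
  rw [← sub_eq_zero]
  refine eq_zero_of_forall_X_pow_dvd fun N => ?_
  induction N generalizing p with
  | zero => simp
  | succ N ih =>
    obtain ⟨q, -, hq⟩ := p.exists_eq_C_add_sum_X_mul
    have : D (φ p) - ∑ i, φ (MvPowerSeries.pderiv k i p) * D (φ (MvPowerSeries.X i)) =
        ∑ j, φ (MvPowerSeries.X j) * (D (φ (q j)) -
          ∑ i, φ (MvPowerSeries.pderiv k i (q j)) * D (φ (MvPowerSeries.X i))) := by
      classical
      have h1 : ∀ i, φ (MvPowerSeries.pderiv k i p) = φ (q i) +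
          ∑ j, φ (MvPowerSeries.X j) * φ (MvPowerSeries.pderiv k i (q j)) := by
        intro i
        conv_lhs => rw [hq]
        simp only [map_add, map_sum, MvPowerSeries.pderiv_C, Derivation.leibniz, smul_eq_mul,
          map_mul, zero_add, Finset.sum_add_distrib, MvPowerSeries.pderiv_X]
        rw [add_comm]
        congr 1
        simp [Pi.single_apply]
      have h2 : D (φ p) = ∑ j, (φ (MvPowerSeries.X j) * D (φ (q j)) +
          φ (q j) * D (φ (MvPowerSeries.X j))) := by
        conv_lhs => rw [hq]
        simp [algHom_C, hC]
      simp only [h1, h2, add_mul, Finset.sum_add_distrib, mul_sub, Finset.sum_sub_distrib,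
        Finset.mul_sum, Finset.sum_mul]
      rw [Finset.sum_comm]
      simp only [mul_assoc]
      ring
    rw [this]
    refine Finset.dvd_sum fun j _ => ?_
    rw [pow_succ']
    exact mul_dvd_mul (X_dvd_algHom_X φ j) (ih _)

/-- Homomorphisms to `k⟦t⟧` are automatically continuous, so they are determined on the
variables. -/
theorem algHom_ext {φ ψ : MvPowerSeries (Fin n) k →ₐ[k] k⟦X⟧}
    (h : ∀ i, φ (MvPowerSeries.X i) = ψ (MvPowerSeries.X i)) : φ = ψ :=
  AlgHom.ext fun p => sub_eq_zero.1 <| eq_zero_of_forall_X_pow_dvd fun _ =>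
    X_pow_dvd_algHom_sub φ ψ (fun i => by simp [h i]) p

theorem hasSubst_of_X_dvd {x : Fin n → k⟦X⟧} (hx : ∀ i, X ∣ x i) : MvPowerSeries.HasSubst x :=
  MvPowerSeries.hasSubst_of_constantCoeff_zero fun i => X_dvd_iff.1 (hx i)

theorem powerSeriesIn_eq_range (φ : MvPowerSeries (Fin n) k →ₐ[k] k⟦X⟧) {x : Fin n → k⟦X⟧}
    (hx : ∀ i, φ (MvPowerSeries.X i) = x i) : powerSeriesIn x = Set.range φ := by
  have hs : MvPowerSeries.HasSubst x := hasSubst_of_X_dvd fun i => hx i ▸ X_dvd_algHom_X φ i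
  have : φ = MvPowerSeries.substAlgHom hs := algHom_ext fun i => by
    rw [hx, MvPowerSeries.substAlgHom_X]
  rw [this, powerSeriesIn, MvPowerSeries.coe_substAlgHom]

/-! ### Roots and changes of uniformizer -/

/-- Roots of power series that are congruent to `1`, by the binomial series. -/
theorem exists_pow_eq_of_X_pow_dvd_sub_one [CharZero k] {u : k⟦X⟧} {N m : ℕ} (hN : N ≠ 0)
    (hm : m ≠ 0) (hu : X ^ N ∣ u - 1) : ∃ β : k⟦X⟧, β ^ m = u ∧ X ^ N ∣ β - 1 := by
  have hs : HasSubst (u - 1) := HasSubst.of_constantCoeff_zero'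
    (X_dvd_iff.1 ((dvd_pow_self X hN).trans hu))
  have hpow : ∀ j : ℕ, binomialSeries k ((m : ℚ)⁻¹) ^ j =
      binomialSeries k ((j : ℚ) * (m : ℚ)⁻¹) := by
    intro j
    induction j with
    | zero => simp
    | succ j ih => rw [pow_succ, ih, ← binomialSeries_add]; congr 1; push_cast; ring
  refine ⟨(binomialSeries k ((m : ℚ)⁻¹)).subst (u - 1), ?_, ?_⟩
  · rw [← subst_pow hs, hpow, mul_inv_cancel₀ (by exact_mod_cast hm)]
    have : binomialSeries k (1 : ℚ) = 1 + X := by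
      simpa using binomialSeries_nat (R := ℚ) (A := k) 1
    rw [this, subst_add hs, subst_X hs, ← coe_substAlgHom hs, map_one]
    ring
  · obtain ⟨g, hg⟩ : X ∣ binomialSeries k ((m : ℚ)⁻¹) - 1 := by
      rw [X_dvd_iff]; simp
    rw [sub_eq_iff_eq_add.1 hg, subst_add hs, subst_mul hs, subst_X hs, ← coe_substAlgHom hs,
      map_one, add_sub_cancel_right]
    exact hu.mul_right _

theorem natCast_le_order_iff {f : k⟦X⟧} {m : ℕ} : (m : ℕ∞) ≤ f.order ↔ X ^ m ∣ f := by
  rw [order_eq_emultiplicity_X, pow_dvd_iff_le_emultiplicity]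

theorem associated_X_of_order_eq_one {s : k⟦X⟧} (hs : s.order = 1) : Associated X s := by
  have h1 := order_eq_nat.1 (show s.order = ((1 : ℕ) : ℕ∞) by simpa using hs)
  obtain ⟨u, rfl⟩ : X ∣ s := X_dvd_iff.2 (by simpa using h1.2 0 one_pos)
  have hu : IsUnit u := by
    rw [isUnit_iff_constantCoeff]
    have := h1.1
    rw [show (1 : ℕ) = 0 + 1 from rfl, coeff_succ_X_mul] at this
    simpa using this
  exact ⟨hu.unit, rfl⟩

theorem hasSubst_of_order_eq_one {s : k⟦X⟧} (hs : s.order = 1) : HasSubst s :=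
  HasSubst.of_constantCoeff_zero' (X_dvd_iff.1 (associated_X_of_order_eq_one hs).dvd)

/-- The automorphism `f ↦ f(s)` of `k⟦t⟧` given by a uniformizer `s`. -/
noncomputable def substAlgEquiv {s : k⟦X⟧} (hs : s.order = 1) : k⟦X⟧ ≃ₐ[k] k⟦X⟧ :=
  have h1 : IsUnit (coeff 1 s) :=
    isUnit_iff_ne_zero.2 (order_eq_nat.1 (show s.order = ((1 : ℕ) : ℕ∞) by simpa using hs)).1
  have h0 : constantCoeff s = 0 := X_dvd_iff.1 (associated_X_of_order_eq_one hs).dvd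
  have h' : HasSubst (s.substInvOfIsUnit h1) := HasSubst.of_constantCoeff_zero' (by simp)
  AlgEquiv.ofAlgHom (substAlgHom (hasSubst_of_order_eq_one hs)) (substAlgHom h')
    (AlgHom.ext fun f => by
      simp only [AlgHom.comp_apply, coe_substAlgHom, AlgHom.id_apply]
      rw [subst_comp_subst_apply h' (hasSubst_of_order_eq_one hs),
        subst_substInvOfIsUnit_left _ h0, X_subst])
    (AlgHom.ext fun f => by
      simp only [AlgHom.comp_apply, coe_substAlgHom, AlgHom.id_apply]
      rw [subst_comp_subst_apply (hasSubst_of_order_eq_one hs) h',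
        subst_substInvOfIsUnit_right _ h0, X_subst])

theorem substAlgEquiv_apply {s : k⟦X⟧} (hs : s.order = 1) (f : k⟦X⟧) :
    substAlgEquiv hs f = subst s f :=
  congrFun (coe_substAlgHom (hasSubst_of_order_eq_one hs)) f

theorem substAlgEquiv_X {s : k⟦X⟧} (hs : s.order = 1) : substAlgEquiv hs X = s := by
  rw [substAlgEquiv_apply, subst_X (hasSubst_of_order_eq_one hs)]

theorem X_pow_dvd_substAlgEquiv_iff {s : k⟦X⟧} (hs : s.order = 1) {f : k⟦X⟧} {m : ℕ} :
    X ^ m ∣ substAlgEquiv hs f ↔ X ^ m ∣ f := by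
  rw [((associated_X_of_order_eq_one hs).pow_pow (n := m)).dvd_iff_dvd_left]
  conv_lhs => lhs; rw [← substAlgEquiv_X hs, ← map_pow]
  exact map_dvd_iff _

theorem order_substAlgEquiv {s : k⟦X⟧} (hs : s.order = 1) (f : k⟦X⟧) :
    (substAlgEquiv hs f).order = f.order :=
  ENat.eq_of_forall_natCast_le_iff fun m => by
    rw [natCast_le_order_iff, natCast_le_order_iff, X_pow_dvd_substAlgEquiv_iff]

/-! ### Homomorphisms with monomial values -/

/-- The subsemigroup of `ℕ` (with `0`) generated by `a₁, …, aₙ`. -/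
def generatedSemigroup (a : Fin n → ℕ) : Set ℕ :=
  {h | ∃ e : Fin n →₀ ℕ, Finsupp.weight a e = h}

variable {a : Fin n → ℕ} {b : Fin n → k}

theorem coeff_algHom_of_monomials (ψ : MvPowerSeries (Fin n) k →ₐ[k] k⟦X⟧)
    (hψ : ∀ i, ψ (MvPowerSeries.X i) = C (b i) * X ^ a i) (p : MvPowerSeries (Fin n) k) (h : ℕ) :
    coeff h (ψ p) = ∑ᶠ e : Fin n →₀ ℕ, MvPowerSeries.coeff e p *
      if Finsupp.weight a e = h then e.prod fun i m => b i ^ m else 0 := by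
  have hs : MvPowerSeries.HasSubst fun i => C (b i) * X ^ a i :=
    hasSubst_of_X_dvd fun i => hψ i ▸ X_dvd_algHom_X ψ i
  have : ψ = MvPowerSeries.substAlgHom hs := algHom_ext fun i => by
    rw [hψ, MvPowerSeries.substAlgHom_X]
  rw [this, MvPowerSeries.coe_substAlgHom, coeff, MvPowerSeries.coeff_subst hs]
  refine finsum_congr fun e => ?_
  rw [smul_eq_mul]
  congr 1
  have : (e.prod fun i m => (C (b i) * X ^ a i : k⟦X⟧) ^ m) =
      C (e.prod fun i m => b i ^ m) * X ^ Finsupp.weight a e := by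
    simp only [Finsupp.prod, Finsupp.weight_apply, Finsupp.sum, map_prod, mul_pow, map_pow,
      Finset.prod_mul_distrib, ← pow_mul, Finset.prod_pow_eq_pow_sum, smul_eq_mul, mul_comm]
  rw [this]
  change coeff h _ = _
  rw [coeff_C_mul, coeff_X_pow]
  simp [eq_comm]

theorem coeff_algHom_of_monomials_eq_zero (ψ : MvPowerSeries (Fin n) k →ₐ[k] k⟦X⟧)
    (hψ : ∀ i, ψ (MvPowerSeries.X i) = C (b i) * X ^ a i) (p : MvPowerSeries (Fin n) k) {h : ℕ}
    (hh : h ∉ generatedSemigroup a) : coeff h (ψ p) = 0 := by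
  rw [coeff_algHom_of_monomials ψ hψ]
  exact finsum_eq_zero_of_forall_eq_zero fun e => by rw [if_neg fun h' => hh ⟨e, h'⟩, mul_zero]

theorem coeff_algHom_of_monomials_of_unique (ψ : MvPowerSeries (Fin n) k →ₐ[k] k⟦X⟧)
    (hψ : ∀ i, ψ (MvPowerSeries.X i) = C (b i) * X ^ a i) (p : MvPowerSeries (Fin n) k) {j : Fin n}
    (hj : ∀ e, Finsupp.weight a e = a j → e = Finsupp.single j 1) :
    coeff (a j) (ψ p) = MvPowerSeries.coeff (Finsupp.single j 1) p * b j := by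
  rw [coeff_algHom_of_monomials ψ hψ, finsum_eq_single _ (Finsupp.single j 1)]
  · rw [if_pos (by simp [Finsupp.weight_apply])]
    simp
  · intro e he
    rw [if_neg fun h => he (hj e h), mul_zero]

theorem range_algHom_of_monomials (ψ : MvPowerSeries (Fin n) k →ₐ[k] k⟦X⟧)
    (hψ : ∀ i, ψ (MvPowerSeries.X i) = X ^ a i) :
    Set.range ψ = {f | ∀ h ∉ generatedSemigroup a, coeff h f = 0} := by
  have hψ' : ∀ i, ψ (MvPowerSeries.X i) = C 1 * X ^ a i := by simpa using hψ
  ext f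
  constructor
  · rintro ⟨p, rfl⟩ h hh
    exact coeff_algHom_of_monomials_eq_zero ψ hψ' p hh
  · intro hf
    classical
    obtain ⟨E, hE⟩ : ∃ E : ℕ → Fin n →₀ ℕ,
        ∀ h ∈ generatedSemigroup a, Finsupp.weight a (E h) = h := by
      choose! E hE using fun (h : ℕ) (hh : h ∈ generatedSemigroup a) => hh
      exact ⟨E, hE⟩
    obtain ⟨p, hp⟩ : ∃ p : MvPowerSeries (Fin n) k, ∀ e, MvPowerSeries.coeff e p =
        if e = E (Finsupp.weight a e) then coeff (Finsupp.weight a e) f else 0 :=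
      ⟨fun e => if e = E (Finsupp.weight a e) then coeff (Finsupp.weight a e) f else 0,
        fun _ => rfl⟩
    refine ⟨p, ?_⟩
    ext h
    by_cases hh : h ∈ generatedSemigroup a
    · rw [coeff_algHom_of_monomials ψ hψ', finsum_eq_single _ (E h)]
      · simp [hp, hE h hh]
      · intro e he
        by_cases hw : Finsupp.weight a e = h
        · rw [hp, if_neg (by rwa [hw]), zero_mul]
        · rw [if_neg hw, mul_zero]
    · rw [coeff_algHom_of_monomials_eq_zero ψ hψ' p hh, hf h hh]

/-- The exponents `aⱼ < a₁ + amin` with `j ≠ r` are irreducible in the generated semigroup. The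
condition excludes the only other possibility, that `aⱼ` is a multiple of `aᵣ`. -/
theorem eq_single_of_weight_eq {r j : Fin n} {a₁ amin : ℕ} (ha : Function.Injective a)
    (ha_pos : ∀ i, 0 < a i) (ha₁ : ∀ i, a₁ ≤ a i) (hamin : ∀ i, i ≠ r → amin ≤ a i)
    (hcond : amin < a r ∨ ∀ i, i ≠ r → ¬ a r ∣ a i) (hjr : j ≠ r) (hj : a j < a₁ + amin)
    {e : Fin n →₀ ℕ} (he : Finsupp.weight a e = a j) : e = Finsupp.single j 1 := by
  have hsingle : ∀ (i : Fin n) (m : ℕ), Finsupp.weight a (Finsupp.single i m) = m * a i := by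
    intro i m
    simp [Finsupp.weight_apply]
  by_cases hi : ∃ i, i ≠ r ∧ e i ≠ 0
  · obtain ⟨i, hir, hi⟩ := hi
    have hle : Finsupp.single i 1 ≤ e := by simpa using Nat.one_le_iff_ne_zero.2 hi
    obtain ⟨e', rfl⟩ := exists_add_of_le hle
    rw [map_add, hsingle, one_mul] at he
    by_cases he' : e' = 0
    · subst he'
      rw [map_zero, add_zero] at he
      rw [add_zero, ha he]
    · obtain ⟨l, hl⟩ : ∃ l, e' l ≠ 0 := by
        by_contra! h
        exact he' (Finsupp.ext h)
      have hle' : Finsupp.single l 1 ≤ e' := by simpa using Nat.one_le_iff_ne_zero.2 hl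
      obtain ⟨e'', rfl⟩ := exists_add_of_le hle'
      rw [map_add, hsingle, one_mul] at he
      have := ha₁ l
      have := hamin i hir
      omega
  · push Not at hi
    have her : e = Finsupp.single r (e r) := by
      ext i
      by_cases h : i = r
      · subst h; simp
      · rw [hi i h, Finsupp.single_eq_of_ne h]
    rw [her, hsingle] at he
    exfalso
    rcases hcond with h | h
    · obtain h0 | h1 | h2 : e r = 0 ∨ e r = 1 ∨ 2 ≤ e r := by omega
      · have := ha_pos j
        rw [h0] at he; omega
      · rw [h1, one_mul] at he
        exact hjr (ha he).symm
      · have := ha₁ r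
        have := Nat.mul_le_mul_right (a r) h2
        omega
    · exact h j hjr ⟨e r, by rw [← he, mul_comm]⟩

/-! ### Subrings generated by perturbed monomials -/

variable {φ : MvPowerSeries (Fin n) k →ₐ[k] k⟦X⟧} {c : ℕ}

theorem mem_range_of_coeff_eq_zero
    (hc : ∀ f, X ^ c ∣ f → f ∈ φ.range) {f : k⟦X⟧}
    (hf : ∀ h, coeff h f ≠ 0 → X ^ h ∈ φ.range) : f ∈ φ.range := by
  have htrunc : f - (trunc c f : Polynomial k) ∈ φ.range := by
    refine hc _ (X_pow_dvd_iff.2 fun m hm => ?_)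
    rw [map_sub, Polynomial.coeff_coe, coeff_trunc, if_pos hm, sub_self]
  have hpoly : ((trunc c f : Polynomial k) : k⟦X⟧) ∈ φ.range := by
    rw [Polynomial.as_sum_support (trunc c f), ← Polynomial.coeToPowerSeries.ringHom_apply,
      map_sum]
    refine sum_mem fun h hh => ?_
    rw [Polynomial.mem_support_iff, coeff_trunc] at hh
    rw [Polynomial.coeToPowerSeries.ringHom_apply, Polynomial.coe_monomial,
      monomial_eq_C_mul_X_pow]
    refine mul_mem (φ.range.algebraMap_mem _) (hf h fun h0 => hh ?_)
    split_ifs <;> simp [h0]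
  simpa using add_mem htrunc hpoly

theorem exists_order_eq_weight
    (hφ : ∀ i, (φ (MvPowerSeries.X i)).order = a i) (e : Fin n →₀ ℕ) :
    ∃ f ∈ φ.range, f.order = (Finsupp.weight a e : ℕ) := by
  refine ⟨φ (e.prod fun i m => MvPowerSeries.X i ^ m), ⟨_, rfl⟩, ?_⟩
  simp only [Finsupp.prod, map_prod, map_pow, order_prod, order_pow, hφ, Finsupp.weight_apply,
    Finsupp.sum]
  push_cast
  simp

theorem X_pow_mem_range_of_mem_generatedSemigroup (hb : ∀ i, b i ≠ 0)
    (hc : ∀ f, X ^ c ∣ f → f ∈ φ.range)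
    (hφ : ∀ i, X ^ c ∣ φ (MvPowerSeries.X i) - C (b i) * X ^ a i) {h : ℕ}
    (hh : h ∈ generatedSemigroup a) : X ^ h ∈ φ.range := by
  have hX : ∀ i, (X : k⟦X⟧) ^ a i ∈ φ.range := fun i => by
    have h1 : C (b i) * X ^ a i ∈ φ.range := by
      simpa using sub_mem (⟨MvPowerSeries.X i, rfl⟩ : φ (MvPowerSeries.X i) ∈ φ.range)
        (hc _ (hφ i))
    have h2 := mul_mem (φ.range.algebraMap_mem (b i)⁻¹) h1
    rwa [show algebraMap k k⟦X⟧ = C from rfl, ← mul_assoc, ← map_mul, inv_mul_cancel₀ (hb i),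
      map_one, one_mul] at h2
  obtain ⟨e, rfl⟩ := hh
  rw [Finsupp.weight_apply, Finsupp.sum, ← Finset.prod_pow_eq_pow_sum]
  refine prod_mem fun i _ => ?_
  rw [smul_eq_mul, mul_comm, pow_mul]
  exact pow_mem (hX i) _

theorem mem_generatedSemigroup_of_coeff_ne_zero
    (ψ : MvPowerSeries (Fin n) k →ₐ[k] k⟦X⟧)
    (hψ : ∀ i, ψ (MvPowerSeries.X i) = C (b i) * X ^ a i)
    (hφ : ∀ i, X ^ c ∣ φ (MvPowerSeries.X i) - C (b i) * X ^ a i) {f : k⟦X⟧} (hf : f ∈ φ.range)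
    {h : ℕ} (hh : coeff h f ≠ 0) (hlt : h < c) : h ∈ generatedSemigroup a := by
  obtain ⟨p, rfl⟩ := hf
  by_contra hmem
  have h1 := X_pow_dvd_iff.1 (X_pow_dvd_algHom_sub φ ψ (fun i => by rw [hψ]; exact hφ i) p) h hlt
  rw [map_sub, coeff_algHom_of_monomials_eq_zero ψ hψ p hmem, sub_zero] at h1
  exact hh h1

theorem exists_algHom_of_monomials (ha_pos : ∀ i, 0 < a i) (b : Fin n → k) :
    ∃ ψ : MvPowerSeries (Fin n) k →ₐ[k] k⟦X⟧,
      ∀ i, ψ (MvPowerSeries.X i) = C (b i) * X ^ a i :=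
  have hs : MvPowerSeries.HasSubst fun i => C (b i) * X ^ a i :=
    hasSubst_of_X_dvd fun i => (dvd_pow_self X (ha_pos i).ne').mul_left _
  ⟨MvPowerSeries.substAlgHom hs, fun i => MvPowerSeries.substAlgHom_X hs i⟩

/-- If the generators are monomials modulo the conductor `t ^ c`, then the subring consists of all
series whose exponents are orders of elements of the subring. -/
theorem mem_range_iff_coeff_eq_zero (ha_pos : ∀ i, 0 < a i) (hb : ∀ i, b i ≠ 0)
    (hc : ∀ f, X ^ c ∣ f → f ∈ φ.range)
    (hφ : ∀ i, X ^ c ∣ φ (MvPowerSeries.X i) - C (b i) * X ^ a i)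
    (hord : ∀ i, (φ (MvPowerSeries.X i)).order = a i) {f : k⟦X⟧} :
    f ∈ φ.range ↔ ∀ h : ℕ, (∀ g ∈ φ.range, g.order ≠ h) → coeff h f = 0 := by
  obtain ⟨ψ, hψ⟩ := exists_algHom_of_monomials ha_pos b
  constructor
  · intro hf h hh
    by_contra h0
    rcases lt_or_ge h c with hlt | hge
    · obtain ⟨e, rfl⟩ := mem_generatedSemigroup_of_coeff_ne_zero ψ hψ hφ hf h0 hlt
      obtain ⟨g, hg, hg'⟩ := exists_order_eq_weight hord e
      exact hh g hg hg'
    · exact hh (X ^ h) (hc _ (pow_dvd_pow X hge)) (order_X_pow h)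
  · intro hf
    refine mem_range_of_coeff_eq_zero hc fun h hh => ?_
    obtain ⟨g, hg, hgo⟩ : ∃ g ∈ φ.range, g.order = h := by
      by_contra! hcon
      exact hh (hf h hcon)
    rcases lt_or_ge h c with hlt | hge
    · exact X_pow_mem_range_of_mem_generatedSemigroup hb hc hφ
        (mem_generatedSemigroup_of_coeff_ne_zero ψ hψ hφ hg (order_eq_nat.1 hgo).1 hlt)
    · exact hc _ (pow_dvd_pow X hge)

/-- Exponents from the conductor on lie in the semigroup generated by the `aᵢ`. Adding `a₁`, it is
enough to consider exponents `h < c + a₁`. If `t ^ h` is the value of `p` at the perturbed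
monomials, then modulo `t ^ (c + a₁)` only the linear coefficients of `p` contribute to the
perturbation. Those that could reach `t ^ h` vanish, because the exponents `aⱼ` in question are
irreducible and `t ^ h` has no terms there. -/
theorem mem_generatedSemigroup_of_X_pow_mem_range {r : Fin n} {a₁ amin o : ℕ}
    (ha : StrictMono a) (ha_pos : ∀ i, 0 < a i) (hb : ∀ i, b i ≠ 0)
    (ha₁ : ∀ i, a₁ ≤ a i) (ha₁' : ∃ i, a i = a₁) (hamin : ∀ i, i ≠ r → amin ≤ a i)
    (hcond : amin < a r ∨ ∀ i, i ≠ r → ¬ a r ∣ a i) (ho : 0 < o) (hco : c ≤ o + amin)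
    (hφr : φ (MvPowerSeries.X r) = C (b r) * X ^ a r)
    (hφ : ∀ i, X ^ (a i + o) ∣ φ (MvPowerSeries.X i) - C (b i) * X ^ a i)
    {h : ℕ} (hch : c ≤ h) (hc : ∀ h, c ≤ h → X ^ h ∈ φ.range) :
    h ∈ generatedSemigroup a := by
  induction h using Nat.strong_induction_on with
  | _ h ih =>
    obtain ⟨i₁, hi₁⟩ := ha₁'
    have ha₁pos : 0 < a₁ := hi₁ ▸ ha_pos i₁
    rcases lt_or_ge h (c + a₁) with hlt | hge
    · by_contra hmem
      obtain ⟨ψ, hψ⟩ := exists_algHom_of_monomials ha_pos b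
      obtain ⟨p, hp⟩ := hc h hch
      change φ p = X ^ h at hp
      set y : Fin n → k⟦X⟧ := fun i => φ (MvPowerSeries.X i) - ψ (MvPowerSeries.X i) with hy
      have hyr : y r = 0 := by simp [hy, hφr, hψ]
      have hyi : ∀ i, X ^ (a i + o) ∣ y i := fun i => by simpa only [hy, hψ] using hφ i
      have hym : ∀ i, X ^ (o + amin) ∣ y i := fun i => by
        by_cases hir : i = r
        · rw [hir, hyr]; exact dvd_zero _
        · have := hamin i hir
          exact (pow_dvd_pow X (by omega)).trans (hyi i)
      have hψa : ∀ i, X ^ a₁ ∣ ψ (MvPowerSeries.X i) := fun i => by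
        rw [hψ]; exact (pow_dvd_pow X (ha₁ i)).mul_left _
      have hφa : ∀ i, X ^ a₁ ∣ φ (MvPowerSeries.X i) := fun i => by
        have h1 : X ^ a₁ ∣ y i := by
          have := ha₁ i
          exact (pow_dvd_pow X (by omega)).trans (hyi i)
        simpa [hy] using dvd_add h1 (hψa i)
      set γ : Fin n → k := fun i => MvPowerSeries.coeff (Finsupp.single i 1) p with hγ
      have hE : ∀ l < o + amin + a₁, coeff l (X ^ h : k⟦X⟧) =
          coeff l (ψ p) + ∑ i, γ i * coeff l (y i) := by
        intro l hl
        have := X_pow_dvd_iff.1 (X_pow_dvd_algHom_sub_sub_sum φ ψ hφa hψa hym p) l hl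
        rw [hp, map_sub, map_sub, map_sum] at this
        simp only [coeff_C_mul] at this
        linear_combination this
      have hylow : ∀ i l, l < a i + o → coeff l (y i) = 0 := fun i l hl =>
        X_pow_dvd_iff.1 (hyi i) l hl
      -- The linear coefficients vanish one after the other, in the order of the exponents.
      have hzero : ∀ j, j ≠ r → a j < h → a j < a₁ + amin → γ j = 0 := by
        intro j
        induction j using WellFoundedLT.induction with
        | _ j ihj =>
          intro hjr hjh hja
          have h1 := hE (a j) (by omega)
          rw [coeff_X_pow, if_neg hjh.ne, coeff_algHom_of_monomials_of_unique ψ hψ p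
            (fun e he => eq_single_of_weight_eq ha.injective ha_pos ha₁ hamin hcond hjr hja he),
            Finset.sum_eq_zero, add_zero] at h1
          · exact (mul_eq_zero.1 h1.symm).resolve_right (hb j)
          · intro i _
            rcases lt_or_ge i j with hij | hij
            · by_cases hir : i = r
              · rw [hir, hyr, map_zero, mul_zero]
              · have := ha hij
                rw [ihj i hij hir (by omega) (by omega), zero_mul]
            · have := ha.monotone hij
              rw [hylow i _ (by omega), mul_zero]
      have h1 := hE h (by omega)
      rw [coeff_X_pow, if_pos rfl, coeff_algHom_of_monomials_eq_zero ψ hψ p hmem,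
        Finset.sum_eq_zero, add_zero] at h1
      · exact one_ne_zero h1
      · intro i _
        by_cases hir : i = r
        · rw [hir, hyr, map_zero, mul_zero]
        · by_cases hi : a i < h ∧ a i < a₁ + amin
          · rw [hzero i hir hi.1 hi.2, zero_mul]
          · rw [hylow i h (by omega), mul_zero]
    · obtain ⟨e, he⟩ := ih (h - a₁) (by omega) (by omega)
      refine ⟨e + Finsupp.single i₁ 1, ?_⟩
      rw [map_add, he]
      simp [Finsupp.weight_apply, hi₁]
      omega

theorem range_eq_of_monomials {r : Fin n} {a₁ amin o : ℕ}
    (ha : StrictMono a) (ha_pos : ∀ i, 0 < a i) (hb : ∀ i, b i ≠ 0)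
    (ha₁ : ∀ i, a₁ ≤ a i) (ha₁' : ∃ i, a i = a₁) (hamin : ∀ i, i ≠ r → amin ≤ a i)
    (hcond : amin < a r ∨ ∀ i, i ≠ r → ¬ a r ∣ a i) (ho : 0 < o) (hco : c ≤ o + amin)
    (hφr : φ (MvPowerSeries.X r) = C (b r) * X ^ a r)
    (hφ : ∀ i, X ^ (a i + o) ∣ φ (MvPowerSeries.X i) - C (b i) * X ^ a i)
    (hc : ∀ f, X ^ c ∣ f → f ∈ φ.range)
    (χ : MvPowerSeries (Fin n) k →ₐ[k] k⟦X⟧) (hχ : ∀ i, χ (MvPowerSeries.X i) = X ^ a i) :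
    Set.range φ = Set.range χ := by
  have hφc : ∀ i, X ^ c ∣ φ (MvPowerSeries.X i) - C (b i) * X ^ a i := fun i => by
    by_cases hir : i = r
    · rw [hir, hφr, sub_self]; exact dvd_zero _
    · have := hamin i hir
      exact (pow_dvd_pow X (by omega)).trans (hφ i)
  have hgen : ∀ h, c ≤ h → h ∈ generatedSemigroup a := fun h hch =>
    mem_generatedSemigroup_of_X_pow_mem_range ha ha_pos hb ha₁ ha₁' hamin hcond ho hco hφr hφ hch
      fun h hh => hc _ (pow_dvd_pow X hh)
  obtain ⟨ψ, hψ⟩ := exists_algHom_of_monomials ha_pos b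
  rw [range_algHom_of_monomials χ hχ]
  ext f
  change f ∈ φ.range ↔ _
  constructor
  · intro hf h hh
    by_contra h0
    rcases lt_or_ge h c with hlt | hge
    · exact hh (mem_generatedSemigroup_of_coeff_ne_zero ψ hψ hφc hf h0 hlt)
    · exact hh (hgen h hge)
  · intro hf
    refine mem_range_of_coeff_eq_zero hc fun h hh =>
      X_pow_mem_range_of_mem_generatedSemigroup hb hc hφc ?_
    by_contra hcon
    exact hh (hf h hcon)

/-! ### The Euler derivation and quasihomogeneity -/

/-- The Euler derivation `s d/ds` of `k⟦t⟧`, for a uniformizer `s`. -/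
noncomputable def eulerDerivation (s : k⟦X⟧) : Derivation k k⟦X⟧ k⟦X⟧ :=
  (s * (derivative k s)⁻¹) • derivative k

theorem eulerDerivation_subst {s : k⟦X⟧} (hs : s.order = 1) (f : k⟦X⟧) :
    eulerDerivation s (subst s f) = subst s (X * derivative k f) := by
  have hs' := hasSubst_of_order_eq_one hs
  have h1 : constantCoeff (derivative k s) ≠ 0 := by
    rw [← coeff_zero_eq_constantCoeff_apply, coeff_derivative]
    simpa using (order_eq_nat.1 (show s.order = ((1 : ℕ) : ℕ∞) by simpa using hs)).1
  rw [eulerDerivation, Derivation.smul_apply, derivative_subst hs', smul_eq_mul, subst_mul hs',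
    subst_X hs']
  linear_combination (s * subst s (derivative k f)) * PowerSeries.inv_mul_cancel _ h1

theorem coeff_X_mul_derivative (f : k⟦X⟧) (h : ℕ) :
    coeff h (X * derivative k f) = h * coeff h f := by
  cases h with
  | zero => simp
  | succ h => rw [coeff_succ_X_mul, coeff_derivative]; push_cast; ring

end PowerSeries

open PowerSeries

/-- The Euler derivation `s d/ds` preserves a ring of all series in `s` with exponents in `H`, and
maps it onto its maximal ideal in characteristic `0`. By the chain rule, `dXᵢ ↦ s dxᵢ/ds`
is then a surjection from the differentials to the maximal ideal. -/
theorem isQuasihomogeneous_of_range_eq_seriesWithExponents {k R : Type*} [Field k] [CharZero k]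
    [CommRing R] [Algebra k R] [IsLocalRing R] [Algebra R k⟦X⟧] [IsScalarTower k R k⟦X⟧]
    (hinj : Function.Injective (algebraMap R k⟦X⟧)) {s : k⟦X⟧} (hs : s.order = 1) {H : Set ℕ}
    (hR : Set.range (algebraMap R k⟦X⟧) = seriesWithExponents s H)
    (hpres : ∃ (n : ℕ) (π : MvPowerSeries (Fin n) k →ₐ[k] R), Function.Surjective π) :
    IsQuasihomogeneous k R := by
  refine ⟨hpres, fun n π hπ => ?_⟩
  let ι : R →ₐ[k] k⟦X⟧ := IsScalarTower.toAlgHom k R k⟦X⟧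
  have hι : ∀ x, ι x = algebraMap R k⟦X⟧ x := fun _ => rfl
  have hmax : ∀ x : R, x ∈ IsLocalRing.maximalIdeal R ↔ constantCoeff (ι x) = 0 := by
    intro x
    rw [IsLocalRing.mem_maximalIdeal, mem_nonunits_iff, not_iff_comm]
    constructor
    · intro hx
      obtain ⟨p, rfl⟩ := hπ x
      have h1 := constantCoeff_algHom (ι.comp π) p
      rw [AlgHom.comp_apply] at h1
      rw [h1] at hx
      exact (MvPowerSeries.isUnit_iff_constantCoeff.2 (isUnit_iff_ne_zero.2 hx)).map π
    · intro hx
      exact ((hx.map ι).map (constantCoeff (R := k))).ne_zero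
  have hD : ∀ x : R, ∃ d : IsLocalRing.maximalIdeal R, ι d = eulerDerivation s (ι x) := by
    intro x
    obtain ⟨f, hf, hfx⟩ : ι x ∈ seriesWithExponents s H := hR ▸ ⟨x, rfl⟩
    obtain ⟨d, hd⟩ : subst s (X * derivative k f) ∈ Set.range (algebraMap R k⟦X⟧) := by
      rw [hR]
      exact ⟨_, fun h hh => by rw [coeff_X_mul_derivative, hf h hh, mul_zero], rfl⟩
    refine ⟨⟨d, (hmax d).2 ?_⟩, ?_⟩
    · rw [hι, hd, subst_mul (hasSubst_of_order_eq_one hs), subst_X (hasSubst_of_order_eq_one hs),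
        map_mul, X_dvd_iff.1 (associated_X_of_order_eq_one hs).dvd, zero_mul]
    · rw [← hfx, eulerDerivation_subst hs]
      exact hd
  choose d hd using fun i => hD (π (MvPowerSeries.X i))
  let Φ : (Fin n → R) →ₗ[R] IsLocalRing.maximalIdeal R := Fintype.linearCombination R d
  have hΦ : ∀ p, ι (Φ fun i => π (MvPowerSeries.pderiv k i p)) = eulerDerivation s (ι (π p)) := by
    intro p
    have h1 := derivation_algHom_apply (eulerDerivation s) (ι.comp π) p
    simp only [AlgHom.comp_apply] at h1
    rw [h1]
    simp only [Φ, Fintype.linearCombination_apply, Submodule.coe_sum, Submodule.coe_smul,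
      smul_eq_mul, map_sum, map_mul, hd]
  have hker : jacobianRelations π ≤ LinearMap.ker Φ := by
    refine Submodule.span_le.2 ?_
    rintro _ ⟨f, hf, rfl⟩
    refine LinearMap.mem_ker.2 (Subtype.ext (hinj ?_))
    rw [← hι, hΦ, hf]
    simp
  refine ⟨(jacobianRelations π).liftQ Φ hker, fun x => ?_⟩
  obtain ⟨f, hf, hfx⟩ : ι x ∈ seriesWithExponents s H := hR ▸ ⟨x, rfl⟩
  have hf0 : coeff 0 f = 0 := by
    have h1 := (hmax x).1 x.2
    have h2 : X ^ 1 ∣ substAlgEquiv hs f := by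
      rw [substAlgEquiv_apply, hfx, pow_one, X_dvd_iff, h1]
    exact X_pow_dvd_iff.1 ((X_pow_dvd_substAlgEquiv_iff hs).1 h2) 0 one_pos
  -- `f` is `X g'` for the series `g` with coefficients `f_h / h`; at `h = 0` both sides vanish.
  have hg : X * derivative k (mk fun h => (h : k)⁻¹ * coeff h f) = f := by
    ext h
    rw [coeff_X_mul_derivative, coeff_mk]
    rcases Nat.eq_zero_or_pos h with rfl | hpos
    · simp [hf0]
    · rw [mul_inv_cancel_left₀ (by exact_mod_cast hpos.ne')]
  obtain ⟨e, he⟩ : subst s (mk fun h => (h : k)⁻¹ * coeff h f) ∈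
      Set.range (algebraMap R k⟦X⟧) := by
    rw [hR]
    exact ⟨_, fun h hh => by rw [coeff_mk, hf h hh, mul_zero], rfl⟩
  obtain ⟨p, rfl⟩ := hπ e
  refine ⟨Submodule.Quotient.mk fun i => π (MvPowerSeries.pderiv k i p), Subtype.ext (hinj ?_)⟩
  change ι (Φ fun i => π (MvPowerSeries.pderiv k i p)) = ι x
  rw [hΦ, hι, he, eulerDerivation_subst hs, hg, hfx]

/-! ### The conductor and the order of a unit -/

theorem mem_range_algebraMap_of_X_pow_dvd {k R Q : Type*} [Field k] [CommRing R] [Field Q]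
    [Algebra R Q] [Algebra R k⟦X⟧] [Algebra k⟦X⟧ Q] [IsScalarTower R k⟦X⟧ Q]
    (hinj : Function.Injective (algebraMap k⟦X⟧ Q)) {c : ℕ}
    (hc : conductorSet R k⟦X⟧ Q =
      algebraMap k⟦X⟧ Q '' (Ideal.span {(PowerSeries.X : k⟦X⟧) ^ c} : Ideal k⟦X⟧))
    {f : k⟦X⟧} (hf : PowerSeries.X ^ c ∣ f) : f ∈ Set.range (algebraMap R k⟦X⟧) := by
  have h1 : algebraMap k⟦X⟧ Q f ∈ conductorSet R k⟦X⟧ Q :=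
    hc ▸ ⟨f, Ideal.mem_span_singleton.2 hf, rfl⟩
  obtain ⟨x, hx⟩ := h1 1
  exact ⟨x, hinj (by rw [← IsScalarTower.algebraMap_apply, hx, map_one, mul_one])⟩

theorem natCast_le_unitOrder_iff {k : Type*} [Field k] {α : k⟦X⟧} {m : ℕ} :
    (m : ℕ∞) ≤ unitOrder α ↔ X ^ m ∣ α - C (constantCoeff α) := natCast_le_order_iff

/-- A finite substitute for the order of a unit, which is infinite if the unit is constant. -/
theorem exists_nat_le_unitOrder {k : Type*} [Field k] {α : k⟦X⟧} {c amin : ℕ}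
    (h : (c : ℕ∞) ≤ unitOrder α + (amin : ℕ∞)) :
    ∃ o : ℕ, 0 < o ∧ (o : ℕ∞) ≤ unitOrder α ∧ c ≤ o + amin := by
  have h1 : ((1 : ℕ) : ℕ∞) ≤ unitOrder α := by
    rw [natCast_le_unitOrder_iff, pow_one, X_dvd_iff]
    simp
  generalize unitOrder α = u at h h1 ⊢
  induction u using ENat.recTopCoe with
  | top => exact ⟨c + 1, by omega, le_top, by omega⟩
  | coe u => exact ⟨u, by exact_mod_cast h1, le_rfl, by exact_mod_cast h⟩

/-! ### Absorbing a unit into the uniformizer -/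

theorem theorem3p1 {k R Q : Type*} [Field k] [IsAlgClosed k] [CharZero k]
    [CommRing R] [IsDomain R] [Algebra k R] [IsLocalRing R] [IsNoetherianRing R]
    [IsAdicComplete (IsLocalRing.maximalIdeal R) R]
    (hdim : ringKrullDim R = 1) (hreg : ¬ IsRegularLocalRing R)
    -- `k⟦t⟧` is the integral closure of `R` in its field of fractions `Q`
    [Field Q] [Algebra R Q] [IsFractionRing R Q]
    [Algebra R k⟦X⟧] [IsScalarTower k R k⟦X⟧]
    [Algebra k⟦X⟧ Q] [IsScalarTower R k⟦X⟧ Q] [IsIntegralClosure k⟦X⟧ R Q]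
    -- the conductor of `R` is `(t ^ c)`
    (c : ℕ)
    (hc : conductorSet R k⟦X⟧ Q =
      algebraMap k⟦X⟧ Q '' (Ideal.span {(PowerSeries.X : k⟦X⟧) ^ c} : Ideal k⟦X⟧))
    -- `R = k⟦α₁ t ^ a₁, …, αₙ t ^ aₙ⟧`
    {n : ℕ} (α : Fin n → k⟦X⟧) (a : Fin n → ℕ)
    (hα : ∀ i, IsUnit (α i)) (ha_pos : ∀ i, 0 < a i) (ha : StrictMono a)
    (hR : Set.range (algebraMap R k⟦X⟧) = powerSeriesIn fun i => α i * PowerSeries.X ^ a i)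
    (r : Fin n) (hr : ∀ i, unitOrder (α r) ≤ unitOrder (α i))
    (amin : ℕ) (hamin : IsLeast {b | ∃ j, j ≠ r ∧ a j = b} amin)
    (h : (c : ℕ∞) ≤ unitOrder (α r) + (amin : ℕ∞)) :
    IsQuasihomogeneous k R ∧
    ∃ s : k⟦X⟧, s.order = 1 ∧
      Set.range (algebraMap R k⟦X⟧) = seriesWithExponents s (valueSemigroup k R) ∧
      (((∃ i, i < r) ∨ ∀ j, j ≠ r → ¬ a r ∣ a j) →
        Set.range (algebraMap R k⟦X⟧) = powerSeriesIn fun i => s ^ a i) := by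
  have hinjQ : Function.Injective (algebraMap k⟦X⟧ Q) :=
    IsIntegralClosure.algebraMap_injective k⟦X⟧ R Q
  have hinj : Function.Injective (algebraMap R k⟦X⟧) := by
    have h1 := IsFractionRing.injective R Q
    rw [IsScalarTower.algebraMap_eq R k⟦X⟧ Q, RingHom.coe_comp] at h1
    exact h1.of_comp
  have hamin' : ∀ i, i ≠ r → amin ≤ a i := fun i hi => hamin.2 ⟨i, hi, rfl⟩
  obtain ⟨o, ho, hor, hco⟩ := exists_nat_le_unitOrder h
  have hαo : ∀ i, X ^ o ∣ α i - C (constantCoeff (α i)) := fun i =>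
    natCast_le_unitOrder_iff.1 (hor.trans (hr i))
  set b : Fin n → k := fun i => constantCoeff (α i) with hb_def
  have hb : ∀ i, b i ≠ 0 := fun i => ((hα i).map (constantCoeff (R := k))).ne_zero
  -- The uniformizer is the `a r`-th root of the generator with index `r`, up to a constant.
  obtain ⟨β, hβ, hβ1⟩ : ∃ β : k⟦X⟧, β ^ a r = C (b r)⁻¹ * α r ∧ X ^ o ∣ β - 1 := by
    refine exists_pow_eq_of_X_pow_dvd_sub_one ho.ne' (ha_pos r).ne' ?_
    have h1 : C (b r)⁻¹ * α r - 1 = C (b r)⁻¹ * (α r - C (b r)) := by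
      rw [mul_sub, ← map_mul, inv_mul_cancel₀ (hb r), map_one]
    rw [h1]
    exact (hαo r).mul_left _
  have hβr : C (b r) * β ^ a r = α r := by
    rw [hβ, ← mul_assoc, ← map_mul, mul_inv_cancel₀ (hb r), map_one, one_mul]
  have hs : (X * β).order = 1 := by
    have h1 : constantCoeff (β - 1) = 0 := X_dvd_iff.1 ((dvd_pow_self X ho.ne').trans hβ1)
    rw [map_sub, map_one, sub_eq_zero] at h1
    rw [order_mul, order_X, order_zero_of_unit (isUnit_iff_constantCoeff.2 (h1 ▸ isUnit_one)),
      add_zero]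
  set s := X * β with hs_def
  let σ := substAlgEquiv hs
  have hxs : MvPowerSeries.HasSubst fun i => α i * X ^ a i :=
    hasSubst_of_X_dvd fun i => (dvd_pow_self X (ha_pos i).ne').mul_left _
  let φx : MvPowerSeries (Fin n) k →ₐ[k] k⟦X⟧ := MvPowerSeries.substAlgHom hxs
  have hφx : ∀ i, φx (MvPowerSeries.X i) = α i * X ^ a i := MvPowerSeries.substAlgHom_X hxs
  have hRx : Set.range (algebraMap R k⟦X⟧) = Set.range φx :=
    hR.trans (powerSeriesIn_eq_range φx hφx)
  -- In terms of the uniformizer `s`, the generators are monomials up to high order.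
  let φ : MvPowerSeries (Fin n) k →ₐ[k] k⟦X⟧ := σ.symm.toAlgHom.comp φx
  have hσφ : ∀ p, σ (φ p) = φx p := fun p => σ.apply_symm_apply _
  have hmem : ∀ f, f ∈ φ.range ↔ σ f ∈ Set.range (algebraMap R k⟦X⟧) := by
    intro f
    rw [hRx]
    exact exists_congr fun p => by
      rw [← hσφ]
      exact σ.injective.eq_iff.symm
  have hσdiff : ∀ i, σ (φ (MvPowerSeries.X i) - C (b i) * X ^ a i) =
      X ^ a i * ((α i - C (b i)) - C (b i) * (β ^ a i - 1)) := by
    intro i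
    rw [map_sub, hσφ, hφx, map_mul, map_pow, show σ X = s from substAlgEquiv_X hs,
      show σ (C (b i)) = C (b i) from σ.commutes (b i), hs_def]
    ring
  have hφ : ∀ i, X ^ (a i + o) ∣ φ (MvPowerSeries.X i) - C (b i) * X ^ a i := by
    intro i
    rw [← X_pow_dvd_substAlgEquiv_iff hs]
    change _ ∣ σ _
    rw [hσdiff, pow_add]
    exact mul_dvd_mul_left _ (dvd_sub (hαo i)
      ((hβ1.trans (sub_one_dvd_pow_sub_one β (a i))).mul_left _))
  have hφr : φ (MvPowerSeries.X r) = C (b r) * X ^ a r := by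
    rw [← sub_eq_zero, ← map_eq_zero_iff σ σ.injective, hσdiff]
    linear_combination -(X ^ a r) * hβr
  have hφc : ∀ i, X ^ c ∣ φ (MvPowerSeries.X i) - C (b i) * X ^ a i := fun i => by
    by_cases hir : i = r
    · rw [hir, hφr, sub_self]; exact dvd_zero _
    · have := hamin' i hir
      exact (pow_dvd_pow X (by omega)).trans (hφ i)
  have hord : ∀ i, (φ (MvPowerSeries.X i)).order = a i := fun i => by
    rw [← order_substAlgEquiv hs]
    change (σ _).order = _
    rw [hσφ, hφx, order_mul, order_zero_of_unit (hα i), zero_add, order_X_pow]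
  have hcond : ∀ f, X ^ c ∣ f → f ∈ φ.range := fun f hf =>
    (hmem f).2 (mem_range_algebraMap_of_X_pow_dvd hinjQ hc
      ((X_pow_dvd_substAlgEquiv_iff hs).2 hf))
  have hval : ∀ m : ℕ, (∀ g ∈ φ.range, g.order ≠ m) ↔ m ∉ valueSemigroup k R := by
    intro m
    constructor
    · rintro hm ⟨x, hx⟩
      refine hm (σ.symm (algebraMap R k⟦X⟧ x)) ((hmem _).2 ⟨x, (σ.apply_symm_apply _).symm⟩) ?_
      rw [← order_substAlgEquiv hs]
      exact (congrArg order (σ.apply_symm_apply _)).trans hx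
    · intro hm g hg hgo
      obtain ⟨x, hx⟩ := (hmem g).1 hg
      exact hm ⟨x, by rw [hx, ← hgo]; exact order_substAlgEquiv hs g⟩
  have hseries : Set.range (algebraMap R k⟦X⟧) = seriesWithExponents s (valueSemigroup k R) := by
    ext g
    have h1 := (hmem (σ.symm g)).symm.trans
      (mem_range_iff_coeff_eq_zero ha_pos hb hcond hφc hord)
    rw [σ.apply_symm_apply] at h1
    rw [h1]
    constructor
    · intro hg
      exact ⟨σ.symm g, fun m hm => hg m ((hval m).2 hm),
        (substAlgEquiv_apply hs _).symm.trans (σ.apply_symm_apply g)⟩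
    · rintro ⟨f, hf, rfl⟩ m hm
      rw [← substAlgEquiv_apply hs]
      change coeff m (σ.symm (σ f)) = 0
      rw [σ.symm_apply_apply]
      exact hf m ((hval m).1 hm)
  have hpres : ∃ (n : ℕ) (π : MvPowerSeries (Fin n) k →ₐ[k] R), Function.Surjective π := by
    let ι : R →ₐ[k] k⟦X⟧ := IsScalarTower.toAlgHom k R k⟦X⟧
    have hle : ∀ p, φx p ∈ ι.range := fun p => by
      have : φx p ∈ Set.range (algebraMap R k⟦X⟧) := hRx ▸ ⟨p, rfl⟩
      exact this
    let e : R ≃ₐ[k] ι.range := AlgEquiv.ofInjective ι hinj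
    refine ⟨n, e.symm.toAlgHom.comp (φx.codRestrict ι.range hle), fun x => ?_⟩
    obtain ⟨p, hp⟩ : algebraMap R k⟦X⟧ x ∈ Set.range φx := hRx ▸ ⟨x, rfl⟩
    refine ⟨p, e.symm_apply_eq.2 (Subtype.ext ?_)⟩
    exact hp
  refine ⟨isQuasihomogeneous_of_range_eq_seriesWithExponents hinj hs hseries hpres, s, hs, hseries,
    fun hdiv => ?_⟩
  have hdiv' : amin < a r ∨ ∀ i, i ≠ r → ¬ a r ∣ a i :=
    hdiv.imp_left fun ⟨i, hi⟩ => (hamin' i hi.ne).trans_lt (ha hi)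
  have hn : 0 < n := r.pos
  obtain ⟨χ, hχ⟩ := exists_algHom_of_monomials ha_pos (fun _ => (1 : k))
  simp only [map_one, one_mul] at hχ
  have hrange := range_eq_of_monomials (a₁ := a ⟨0, hn⟩) ha ha_pos hb
    (fun i => ha.monotone (Nat.zero_le _)) ⟨_, rfl⟩ hamin' hdiv' ho hco hφr hφ hcond χ hχ
  rw [powerSeriesIn_eq_range (σ.toAlgHom.comp χ) fun i => ?_]
  · ext g
    have h1 := (hmem (σ.symm g)).symm
    rw [σ.apply_symm_apply] at h1
    rw [h1]
    change σ.symm g ∈ Set.range φ ↔ _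
    rw [hrange]
    exact exists_congr fun p => σ.eq_symm_apply
  · change σ (χ _) = _
    rw [hχ, map_pow, show σ X = s from substAlgEquiv_X hs]
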